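/- Let $n\ge 1$, $q\in\mathbb{R}^M$ with $q_j>0$ for all $j$, and for $k=1,\dots,n$ let $A^k\in\mathbb{R}^{m_k\times M}$, $b^k\in\mathbb{R}^{m_k}$. Let $\Delta_M$ be the probability simplex, $\mathcal C^k=\{x\in\Delta_M : A^kx=b^k\}$ and $\mathcal C=\bigcap_{k=1}^n\mathcal C^k$, and assume $\mathcal C\neq\emptyset$. Write $$\mathrm{KL}(p,r)=\sum_{j}\Big(p_j\log\frac{p_j}{r_j}-p_j+r_j\Big)$$ if $p,r\ge0$ and $r_j=0\Rightarrow p_j=0$ (with $0\log 0=0\log\frac00=0$), and $\mathrm{KL}(p,r)=\infty$ otherwise; let $P^{\mathrm{KL}}_S(r)=\operatorname{argmin}_{p\in S}\mathrm{KL}(p,r)$. Let $I\subset\{1,\dots,n\}$. For $k\in I$ replace $(A^k,b^k)$ by a normalized system $(\hat A^k,\hat b^k)$ as follows: choose $\xi_k,\xi_k'$ such that all entries of $A^k-\xi_k$ and $b^k-\xi_k$ (entrywise subtraction) are nonnegative and $\xi'_k$ is at least every column sum of $A^k-\xi_k$ and at least the sum of the entries of $b^k-\xi_k$ (for instance $\xi_k=\min\{\min_{ij}A^k_{ij},\min_i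 b^k_i\}$ and $\xi_k'$ the maximum of these sums); divide $A^k-\xi_k$ and $b^k-\xi_k$ by $\xi'_k$ (if $\xi_k'=0$, both are zero and remain zero); delete the rows in which all entries and the right-hand side vanish; finally append one row making all column sums of $\hat A^k$ and the sum of the entries of $\hat b^k$ equal to $1$. Extend the index $k$ of $A^k,b^k,\hat A^k,\hat b^k,\mathcal C^k$ periodically with period $n$, and consider the iteration $p^{(0)}=q$ and, for $k=1,2,\dots$, $$p^{(k)}_j=p^{(k-1)}_j\prod_{i}\Big(\frac{\hat b^k_i}{(\hat A^kp^{(k-1)})_i}\Big)^{\hat A^k_{ij}}\ (j=1,\dots,M)\quad\text{if } k\in I+n\mathbb{N}_0,\qquad p^{(k)}=P^{\mathrm{KL}}_{\mathcal C^k}(p^{(k-1)})\quad\text{otherwise,}$$ with the conventions $0^0=1$ and $\frac00=0$. (For $\hat b^k>0$ the first case is $p^{(k-1)}\odot\exp\big((\hat A^k)^{\top}\log\frac{\hat b^k}{\hat A^kp^{(k-1)}}\big)$.) Then the iteration is well defined (every projection in it exists and is unique), the projection $P^{\mathrm{KL}}_{\mathcal C}(q)$ exists and is unique, and $$\lim_{k\to\infty}p^{(k)}=P^{\mathrm{KL}}_{\mathcal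 C}(q)=\operatorname*{argmin}_{p\in\mathcal C}\mathrm{KL}(p,q).$$ -/

import Mathlib

open Filter Topology

namespace KLMix

/-- The Kullback–Leibler divergence of two real vectors, with values in `ℝ ∪ {∞}`. The conventions
`0 log 0 = 0 log (0/0) = 0` hold since the factor in front of the logarithm is `0`. -/
noncomputable def KL {M : ℕ} (p q : Fin M → ℝ) : EReal :=
  open Classical in
  if (∀ j, 0 ≤ p j) ∧ (∀ j, 0 ≤ q j) ∧ (∀ j, q j = 0 → p j = 0) then
    ((∑ j, (p j * Real.log (p j / q j) - p j + q j) : ℝ) : EReal)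
  else ⊤

/-- `C(A, b)`: the affine subset `{x ∈ Δ_M : A x = b}` of the probability simplex. -/
def affineSubset {m M : ℕ} (A : Matrix (Fin m) (Fin M) ℝ) (b : Fin m → ℝ) : Set (Fin M → ℝ) :=
  {x | x ∈ stdSimplex ℝ (Fin M) ∧ A.mulVec x = b}

/-- `x` is a KL (information) projection of `r` onto `S`, that is, `x ∈ argmin_{p ∈ S} KL(p, r)`. -/
def IsKLProj {M : ℕ} (S : Set (Fin M → ℝ)) (r x : Fin M → ℝ) : Prop :=
  x ∈ S ∧ ∀ y ∈ S, KL x r ≤ KL y r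

section Normalization

variable {m M : ℕ}

/-- The shifted and rescaled matrix `(A - ξ) / ξ'` (entrywise). -/
noncomputable def scaledMatrix (A : Matrix (Fin m) (Fin M) ℝ) (ξ ξ' : ℝ) :
    Matrix (Fin m) (Fin M) ℝ :=
  Matrix.of fun i j => (1 / ξ') * (A i j - ξ)

/-- The shifted and rescaled right-hand side `(b - ξ) / ξ'` (entrywise). -/
noncomputable def scaledRhs (b : Fin m → ℝ) (ξ ξ' : ℝ) : Fin m → ℝ :=
  fun i => (1 / ξ') * (b i - ξ)

/-- The values of shift `ξ` and scale `ξ'` that may be used to normalize the system `A x = b`: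
after subtracting `ξ` all entries of `A` and `b` are nonnegative, and `ξ'` is at least every
column sum of the shifted matrix and at least the sum of the shifted right-hand side.
(`ξ' = 0` is possible only if the shifted system is `0 = 0`.) -/
structure IsAdmissible (A : Matrix (Fin m) (Fin M) ℝ) (b : Fin m → ℝ) (ξ ξ' : ℝ) : Prop where
  shift_le_matrix : ∀ i j, ξ ≤ A i j
  shift_le_rhs : ∀ i, ξ ≤ b i
  colSum_le_scale : ∀ j, ∑ i, (A i j - ξ) ≤ ξ'
  rhsSum_le_scale : ∑ i, (b i - ξ) ≤ ξ'

/-- The smallest-modification shift `ξ = min {min_{ij} A_{ij}, min_i b_i}`. -/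
noncomputable def minShift (A : Matrix (Fin m) (Fin M) ℝ) (b : Fin m → ℝ) : ℝ :=
  min (⨅ i, ⨅ j, A i j) (⨅ i, b i)

/-- The scale `ξ' = max {max_j (𝟙ᵀ A⁽¹⁾)_j, 𝟙ᵀ b⁽¹⁾}` belonging to the shift `ξ = minShift A b`,
where `A⁽¹⁾ = A - ξ` and `b⁽¹⁾ = b - ξ`. -/
noncomputable def minScale (A : Matrix (Fin m) (Fin M) ℝ) (b : Fin m → ℝ) : ℝ :=
  max (⨆ j, ∑ i, (A i j - minShift A b)) (∑ i, (b i - minShift A b))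

/-- The standard choice of shift and scale is admissible. -/
theorem isAdmissible_min (A : Matrix (Fin m) (Fin M) ℝ) (b : Fin m → ℝ) :
    IsAdmissible A b (minShift A b) (minScale A b) where
  shift_le_matrix i j :=
    (min_le_left _ _).trans
      ((ciInf_le (Set.finite_range _).bddBelow i).trans
        (ciInf_le (Set.finite_range fun j => A i j).bddBelow j))
  shift_le_rhs i := (min_le_right _ _).trans (ciInf_le (Set.finite_range _).bddBelow i)
  colSum_le_scale j :=
    (le_ciSup (f := fun j => ∑ i, (A i j - minShift A b)) (Set.finite_range _).bddAbove j).trans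
      (le_max_left _ _)
  rhsSum_le_scale := le_max_right _ _

/-- The rows of the normalized system: the rows of the scaled system in which not all entries
(including the right-hand side) vanish, together with one additional row `none`. -/
abbrev NormRow (A : Matrix (Fin m) (Fin M) ℝ) (b : Fin m → ℝ) (ξ ξ' : ℝ) : Type :=
  Option {i : Fin m // ¬ ((∀ j, scaledMatrix A ξ ξ' i j = 0) ∧ scaledRhs b ξ ξ' i = 0)}

noncomputable instance instFintypeNormRow (A : Matrix (Fin m) (Fin M) ℝ) (b : Fin m → ℝ)
    (ξ ξ' : ℝ) : Fintype (NormRow A b ξ ξ') :=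
  Fintype.ofFinite _

/-- The normalized matrix; the additional row complements the column sums to `1`. -/
noncomputable def normMatrix (A : Matrix (Fin m) (Fin M) ℝ) (b : Fin m → ℝ) (ξ ξ' : ℝ) :
    Matrix (NormRow A b ξ ξ') (Fin M) ℝ :=
  Matrix.of fun r j =>
    match r with
    | some i => scaledMatrix A ξ ξ' i.1 j
    | none => 1 - ∑ i, scaledMatrix A ξ ξ' i j

/-- The normalized right-hand side; the additional entry complements the sum to `1`. -/
noncomputable def normRhs (A : Matrix (Fin m) (Fin M) ℝ) (b : Fin m → ℝ) (ξ ξ' : ℝ) :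
    NormRow A b ξ ξ' → ℝ :=
  fun r =>
    match r with
    | some i => scaledRhs b ξ ξ' i.1
    | none => 1 - ∑ i, scaledRhs b ξ ξ' i

end Normalization

/-- One generalized iterative scaling (SMART) step
`p ⊙ exp (Aᵀ log (b / (A p))) = p ⊙ ∏ i, (b / (A p))_i ^ A_{i,:}`, in the product form, which makes
sense also when `b` has zero entries (`0 ^ 0 = 1`, and `0 ^ a = 0` for `a > 0`). -/
noncomputable def gisStep {ι : Type} [Fintype ι] {M : ℕ} (A : Matrix ι (Fin M) ℝ) (b : ι → ℝ)
    (p : Fin M → ℝ) : Fin M → ℝ :=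
  fun j => p j * ∏ i, (b i / A.mulVec p i) ^ (A i j)

/-- `p⁽⁰⁾, p⁽¹⁾, …` is a run of the cyclic scheme started at `q`. The `n` blocks are indexed from
`0`, so that step `k + 1` (from `p⁽ᵏ⁾` to `p⁽ᵏ⁺¹⁾`) uses block `k mod n`: a single GIS step for the
normalized system if that block lies in `I`, and an exact KL projection otherwise. -/
structure IsRun {n M : ℕ} [NeZero n] {m : Fin n → ℕ} (q : Fin M → ℝ) (I : Set (Fin n))
    (A : (k : Fin n) → Matrix (Fin (m k)) (Fin M) ℝ) (b : (k : Fin n) → Fin (m k) → ℝ)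
    (ξ ξ' : Fin n → ℝ) (p : ℕ → Fin M → ℝ) : Prop where
  init : p 0 = q
  gis : ∀ k : ℕ, ∀ i : Fin n, i = Fin.ofNat n k → i ∈ I →
    p (k + 1) = gisStep (normMatrix (A i) (b i) (ξ i) (ξ' i)) (normRhs (A i) (b i) (ξ i) (ξ' i)) (p k)
  proj : ∀ k : ℕ, ∀ i : Fin n, i = Fin.ofNat n k → i ∉ I →
    IsKLProj (affineSubset (A i) (b i)) (p k) (p (k + 1))

end KLMix

/-!
Every step `p ↦ p'` of the scheme decreases `KL(x, ·)` by the same amount for all `x ∈ C`. For a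
projection this is the Pythagorean identity on affine subspaces; for a scaling step it holds because
the logarithm of the multiplicative update is a linear combination of the rows of `Â`, so that its
pairing with `x` depends only on `Â x = b̂`. Since `KL(x, ·) ≥ 0`, the decreases tend to `0`. A
decrease bounds `KL(p', p)` or `KL(b̂, Â p)`, and the divergence bounds the squared Hellinger
distance, so along a convergent subsequence all `n` steps of a cycle share their limit `y`, and this
limit lies in every `C^k`. Now `KL(y, p^(k))` is nonincreasing with a subsequence tending to `0`,
hence `p^(k) → y`. Summing the equal decreases,
`KL(x, q) - lim KL(x, p^(k)) = KL(y, q)` for all `x ∈ C`, hence `KL(y, q) ≤ KL(x, q)`.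
-/

namespace KLMix

open InformationTheory Set
open scoped Matrix

/-- `p ≪ r`: both vectors are nonnegative and `p` vanishes wherever `r` does. These are exactly the
pairs with finite Kullback–Leibler divergence. -/
structure Dominated {ι : Type*} (p r : ι → ℝ) : Prop where
  nonneg_left : 0 ≤ p
  nonneg_right : 0 ≤ r
  eq_zero : ∀ j, r j = 0 → p j = 0

local infix:50 " ≪ " => Dominated

namespace Dominated

variable {ι : Type*} {p r x y z : ι → ℝ} {t : ℝ}

theorem refl (hp : 0 ≤ p) : p ≪ p := ⟨hp, hp, fun _ => id⟩

theorem trans (hpz : p ≪ z) (hzr : z ≪ r) : p ≪ r :=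
  ⟨hpz.nonneg_left, hzr.nonneg_right, fun j hj => hpz.eq_zero j (hzr.eq_zero j hj)⟩

theorem pos_right (h : p ≪ r) {j : ι} (hj : p j ≠ 0) : 0 < r j :=
  (h.nonneg_right j).lt_of_ne' (mt (h.eq_zero j) hj)

theorem of_pos (hp : 0 ≤ p) (hr : ∀ j, 0 < r j) : p ≪ r :=
  ⟨hp, fun j => (hr j).le, fun j hj => absurd hj (hr j).ne'⟩

theorem isClosed_setOf (hr : 0 ≤ r) : IsClosed {p | p ≪ r} := by
  have hset : {p | p ≪ r} = Ici 0 ∩ ⋂ j, ⋂ (_ : r j = 0), {p | p j = 0} := by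
    ext p
    simp only [mem_inter_iff, mem_Ici, mem_iInter]
    exact ⟨fun h => ⟨h.nonneg_left, h.eq_zero⟩, fun h => ⟨h.1, hr, h.2⟩⟩
  rw [hset]
  exact isClosed_Ici.inter <| isClosed_iInter fun j => isClosed_iInter fun _ =>
    isClosed_eq (continuous_apply j) continuous_const

theorem lineMap (hx : x ≪ r) (hy : y ≪ r) (hz : 0 ≤ AffineMap.lineMap x y t) :
    AffineMap.lineMap x y t ≪ r :=
  ⟨hz, hx.nonneg_right, fun j hj => by
    simp [AffineMap.lineMap_apply_module, hx.eq_zero j hj, hy.eq_zero j hj]⟩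

theorem lineMap_right (hx : 0 ≤ x) (hy : 0 ≤ y) (ht : 0 < t) (ht1 : t ≤ 1) :
    y ≪ AffineMap.lineMap x y t := by
  have hx' : ∀ j, 0 ≤ (1 - t) * x j := fun j => mul_nonneg (sub_nonneg.2 ht1) (hx j)
  have hy' : ∀ j, 0 ≤ t * y j := fun j => mul_nonneg ht.le (hy j)
  have hz : ∀ j, AffineMap.lineMap x y t j = (1 - t) * x j + t * y j := by
    simp [AffineMap.lineMap_apply_module]
  refine ⟨hy, fun j => hz j ▸ add_nonneg (hx' j) (hy' j), fun j hj => ?_⟩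
  have : t * y j = 0 := by linarith [hz j, hx' j, hy' j]
  exact (mul_eq_zero.1 this).resolve_left ht.ne'

theorem lineMap_left (hx : 0 ≤ x) (hy : 0 ≤ y) (ht : 0 ≤ t) (ht1 : t < 1) :
    x ≪ AffineMap.lineMap x y t := by
  rw [← AffineMap.lineMap_apply_one_sub]
  exact lineMap_right hy hx (sub_pos.2 ht1) (sub_le_self _ ht)

theorem eventually_lineMap [Finite ι] (h : y ≪ x) :
    ∀ᶠ t : ℝ in 𝓝 0, x ≪ AffineMap.lineMap x y t := by
  have hcoord : ∀ j, ∀ᶠ t : ℝ in 𝓝 0, 0 ≤ AffineMap.lineMap x y t j ∧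
      (AffineMap.lineMap x y t j = 0 → x j = 0) := fun j => by
    by_cases hj : x j = 0
    · simp [AffineMap.lineMap_apply_module, hj, h.eq_zero j hj]
    · have hcont : Tendsto (fun t : ℝ => AffineMap.lineMap x y t j) (𝓝 0) (𝓝 (x j)) := by
        have hc : Continuous fun t : ℝ => AffineMap.lineMap x y t j :=
          (continuous_apply j).comp AffineMap.lineMap_continuous
        simpa using hc.tendsto 0
      filter_upwards [hcont.eventually_const_lt ((h.nonneg_right j).lt_of_ne' hj)] with t ht
      exact ⟨ht.le, fun h0 => absurd h0 ht.ne'⟩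
  filter_upwards [eventually_all.2 hcoord] with t ht
  exact ⟨h.nonneg_right, fun j => (ht j).1, fun j => (ht j).2⟩

end Dominated

theorem sq_sqrt_sub_one_le_klFun {x : ℝ} (hx : 0 ≤ x) : (√x - 1) ^ 2 ≤ klFun x := by
  rcases hx.eq_or_lt with rfl | hx
  · simp [klFun_zero]
  have hs : 0 < √x := Real.sqrt_pos.2 hx
  have hlog : 2 * (1 - (√x)⁻¹) ≤ Real.log x := by
    rw [← mul_div_cancel₀ (Real.log x) two_ne_zero, ← Real.log_sqrt hx.le]
    gcongr
    exact Real.one_sub_inv_le_log_of_pos hs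
  have hsx : x * (√x)⁻¹ = √x := by rw [← div_eq_mul_inv, Real.div_sqrt]
  calc (√x - 1) ^ 2 = x * (2 * (1 - (√x)⁻¹)) + 1 - x := by
        linear_combination Real.sq_sqrt hx.le + 2 * hsx
    _ ≤ klFun x := by
        rw [klFun_apply]
        gcongr

theorem sq_sqrt_sub_sqrt_le_mul_klFun {a b : ℝ} (ha : 0 ≤ a) (hb : 0 ≤ b) (hab : b = 0 → a = 0) :
    (√a - √b) ^ 2 ≤ b * klFun (a / b) := by
  rcases hb.eq_or_lt with rfl | hb
  · simp [hab rfl]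
  have hs : √b ≠ 0 := (Real.sqrt_pos.2 hb).ne'
  calc (√a - √b) ^ 2 = √b ^ 2 * (√(a / b) - 1) ^ 2 := by
        rw [Real.sqrt_div ha]
        field_simp
    _ = b * (√(a / b) - 1) ^ 2 := by rw [Real.sq_sqrt hb.le]
    _ ≤ b * klFun (a / b) := by
        gcongr
        exact sq_sqrt_sub_one_le_klFun (div_nonneg ha hb.le)

theorem mul_klFun_div {a b : ℝ} (hab : b = 0 → a = 0) :
    b * klFun (a / b) = a * Real.log (a / b) - a + b := by
  by_cases hb : b = 0
  · simp [hb, hab hb]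
  · rw [klFun_apply]
    field_simp
    ring

theorem mul_klFun_div_sub {a b c : ℝ} (hac : c = 0 → a = 0) (hcb : b = 0 → c = 0) :
    b * klFun (a / b) - c * klFun (a / c) = a * Real.log (c / b) + (b - c) := by
  rw [mul_klFun_div (hac ∘ hcb), mul_klFun_div hac]
  by_cases ha : a = 0
  · simp [ha]
  have hc : c ≠ 0 := mt hac ha
  have hb : b ≠ 0 := mt hcb hc
  rw [Real.log_div ha hb, Real.log_div ha hc, Real.log_div hc hb]
  ring

theorem tendsto_mul_klFun_div {α : Type*} {l : Filter α} {f : α → ℝ} {a b : ℝ}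
    (hab : b = 0 → a = 0) (hf : Tendsto f l (𝓝 b)) :
    Tendsto (fun k => f k * klFun (a / f k)) l (𝓝 (b * klFun (a / b))) := by
  by_cases hb : b = 0
  · simpa [hb, hab hb, klFun_zero] using hf
  · exact hf.mul ((continuous_klFun.tendsto _).comp (tendsto_const_nhds.div hf hb))

theorem tendsto_of_tendsto_sqrt_sub_sqrt {α : Type*} {l : Filter α} {u v : α → ℝ} {a : ℝ}
    (hu : ∀ᶠ k in l, 0 ≤ u k) (hv : ∀ᶠ k in l, 0 ≤ v k)
    (huv : Tendsto (fun k => √(u k) - √(v k)) l (𝓝 0)) (hua : Tendsto u l (𝓝 a)) :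
    Tendsto v l (𝓝 a) := by
  have hsv : Tendsto (fun k => √(v k)) l (𝓝 √a) := by simpa using hua.sqrt.sub huv
  have hdiff : Tendsto (fun k => u k - v k) l (𝓝 0) := by
    have hprod := huv.mul (hua.sqrt.add hsv)
    rw [zero_mul] at hprod
    refine hprod.congr' ?_
    filter_upwards [hu, hv] with k hu hv
    linear_combination Real.sq_sqrt hu - Real.sq_sqrt hv
  simpa using hua.sub hdiff

section KLSum

variable {ι : Type*} [Fintype ι]

/-- The real-valued Kullback–Leibler divergence `∑ r_j φ(p_j / r_j)`, `φ(x) = x log x + 1 - x`; it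
agrees with `KL p r` if `p ≪ r`. In this form every summand is nonnegative and continuous in `p`,
also where `r_j = 0` (then the summand is `0`). -/
noncomputable def klSum (p r : ι → ℝ) : ℝ := ∑ j, r j * klFun (p j / r j)

variable {p r x y z : ι → ℝ} {t : ℝ}

theorem klSum_nonneg (hp : 0 ≤ p) (hr : 0 ≤ r) : 0 ≤ klSum p r :=
  Finset.sum_nonneg fun j _ => mul_nonneg (hr j) (klFun_nonneg (div_nonneg (hp j) (hr j)))

theorem mul_klFun_div_le_klSum (hp : 0 ≤ p) (hr : 0 ≤ r) (j : ι) :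
    r j * klFun (p j / r j) ≤ klSum p r :=
  Finset.single_le_sum (f := fun j => r j * klFun (p j / r j))
    (fun j _ => mul_nonneg (hr j) (klFun_nonneg (div_nonneg (hp j) (hr j)))) (Finset.mem_univ j)

theorem Dominated.sq_sqrt_sub_sqrt_le_klSum (h : p ≪ r) (j : ι) :
    (√(p j) - √(r j)) ^ 2 ≤ klSum p r :=
  (sq_sqrt_sub_sqrt_le_mul_klFun (h.nonneg_left j) (h.nonneg_right j) (h.eq_zero j)).trans
    (mul_klFun_div_le_klSum h.nonneg_left h.nonneg_right j)

theorem klSum_self (p : ι → ℝ) : klSum p p = 0 :=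
  Finset.sum_eq_zero fun j _ => by by_cases h : p j = 0 <;> simp [h, klFun_one]

theorem Dominated.eq_of_klSum_nonpos (h : p ≪ r) (hle : klSum p r ≤ 0) : p = r := by
  funext j
  have hsq : (√(p j) - √(r j)) ^ 2 = 0 :=
    le_antisymm ((h.sq_sqrt_sub_sqrt_le_klSum j).trans hle) (sq_nonneg _)
  exact (Real.sqrt_inj (h.nonneg_left j) (h.nonneg_right j)).1
    (sub_eq_zero.1 (sq_eq_zero_iff.1 hsq))

theorem continuous_klSum_left (r : ι → ℝ) : Continuous fun p => klSum p r :=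
  continuous_finsetSum _ fun j _ =>
    continuous_const.mul (continuous_klFun.comp ((continuous_apply j).div_const _))

section Limits

variable {α : Type*} {l : Filter α} {f g : α → ι → ℝ}

theorem Dominated.tendsto_klSum (h : p ≪ r) (hf : Tendsto f l (𝓝 r)) :
    Tendsto (fun k => klSum p (f k)) l (𝓝 (klSum p r)) :=
  tendsto_finsetSum _ fun j _ => tendsto_mul_klFun_div (h.eq_zero j) (tendsto_pi_nhds.1 hf j)

theorem tendsto_iff_of_tendsto_klSum (h : ∀ᶠ k in l, f k ≪ g k)
    (hlim : Tendsto (fun k => klSum (f k) (g k)) l (𝓝 0)) :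
    Tendsto f l (𝓝 y) ↔ Tendsto g l (𝓝 y) := by
  have hsqrt : ∀ j, Tendsto (fun k => √(f k j) - √(g k j)) l (𝓝 0) := fun j => by
    have hsq : Tendsto (fun k => (√(f k j) - √(g k j)) ^ 2) l (𝓝 0) :=
      squeeze_zero' (.of_forall fun k => sq_nonneg _)
        (h.mono fun k hk => hk.sq_sqrt_sub_sqrt_le_klSum j) hlim
    rw [tendsto_zero_iff_abs_tendsto_zero]
    simpa [Function.comp_def, Real.sqrt_sq_eq_abs] using hsq.sqrt
  have hf : ∀ j, ∀ᶠ k in l, 0 ≤ f k j := fun j => h.mono fun k hk => hk.nonneg_left j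
  have hg : ∀ j, ∀ᶠ k in l, 0 ≤ g k j := fun j => h.mono fun k hk => hk.nonneg_right j
  simp only [tendsto_pi_nhds]
  refine forall_congr' fun j => ⟨tendsto_of_tendsto_sqrt_sub_sqrt (hf j) (hg j) (hsqrt j),
    tendsto_of_tendsto_sqrt_sub_sqrt (hg j) (hf j) ?_⟩
  simpa using (hsqrt j).neg

end Limits

theorem Dominated.klSum_sub_klSum (hpz : p ≪ z) (hzr : z ≪ r) :
    klSum p r - klSum p z = ∑ j, p j * Real.log (z j / r j) + (∑ j, r j - ∑ j, z j) := by
  rw [klSum, klSum, ← Finset.sum_sub_distrib, ← Finset.sum_sub_distrib, ← Finset.sum_add_distrib]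
  exact Finset.sum_congr rfl fun j _ => mul_klFun_div_sub (hpz.eq_zero j) (hzr.eq_zero j)

theorem Dominated.klSum_eq (h : p ≪ r) :
    klSum p r = ∑ j, p j * Real.log (p j / r j) + (∑ j, r j - ∑ j, p j) := by
  simpa [klSum_self] using (refl h.nonneg_left).klSum_sub_klSum h

/-- `y ↦ KL(y, r) - KL(y, z)` is affine, with value `KL(z, r)` at `y = z`. -/
theorem klSum_lineMap (hx : x ≪ AffineMap.lineMap x y t) (hy : y ≪ AffineMap.lineMap x y t)
    (hr : AffineMap.lineMap x y t ≪ r) :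
    klSum (AffineMap.lineMap x y t) r =
      (1 - t) * (klSum x r - klSum x (AffineMap.lineMap x y t)) +
        t * (klSum y r - klSum y (AffineMap.lineMap x y t)) := by
  rw [hr.klSum_eq, hx.klSum_sub_klSum hr, hy.klSum_sub_klSum hr]
  set c : ι → ℝ := fun j => Real.log (AffineMap.lineMap x y t j / r j)
  have hlog : ∑ j, AffineMap.lineMap x y t j * c j =
      (1 - t) * ∑ j, x j * c j + t * ∑ j, y j * c j := by
    rw [Finset.mul_sum, Finset.mul_sum, ← Finset.sum_add_distrib]
    refine Finset.sum_congr rfl fun j _ => ?_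
    simp only [AffineMap.lineMap_apply_module, Pi.add_apply, Pi.smul_apply, smul_eq_mul]
    ring
  rw [hlog]
  ring

end KLSum

section Projection

variable {M : ℕ} {p r x y : Fin M → ℝ} {t : ℝ} {S : Set (Fin M → ℝ)}

theorem Dominated.KL_eq (h : p ≪ r) : KL p r = klSum p r := by
  rw [KL, if_pos ⟨h.nonneg_left, h.nonneg_right, h.eq_zero⟩, klSum]
  exact congrArg _ (Finset.sum_congr rfl fun j _ => (mul_klFun_div (h.eq_zero j)).symm)

theorem KL_ne_top_iff : KL p r ≠ ⊤ ↔ p ≪ r := by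
  refine ⟨fun h => ?_, fun h => h.KL_eq ▸ EReal.coe_ne_top _⟩
  by_contra hpr
  exact h (if_neg fun h' => hpr ⟨h'.1, h'.2.1, h'.2.2⟩)

theorem IsKLProj.dominated (h : IsKLProj S r x) (hy : y ∈ S) (hyr : y ≪ r) : x ≪ r :=
  KL_ne_top_iff.1 ((h.2 y hy).trans_lt (KL_ne_top_iff.2 hyr).lt_top).ne

theorem IsKLProj.klSum_le (h : IsKLProj S r x) (hy : y ∈ S) (hyr : y ≪ r) :
    klSum x r ≤ klSum y r := by
  have hle := h.2 y hy
  rwa [(h.dominated hy hyr).KL_eq, hyr.KL_eq, EReal.coe_le_coe_iff] at hle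

theorem isKLProj_of_forall_klSum_le (hx : x ∈ S) (hxr : x ≪ r)
    (hmin : ∀ y ∈ S, y ≪ r → klSum x r ≤ klSum y r) : IsKLProj S r x := by
  refine ⟨hx, fun y hy => ?_⟩
  by_cases hyr : y ≪ r
  · rw [hxr.KL_eq, hyr.KL_eq, EReal.coe_le_coe_iff]
    exact hmin y hy hyr
  · rw [not_ne_iff.1 (mt KL_ne_top_iff.1 hyr)]
    exact le_top

theorem IsKLProj.mul_klSum_add_le (h : IsKLProj S r x) (hxr : x ≪ r) (hyr : y ≪ r)
    (hz : AffineMap.lineMap x y t ∈ S) (hxz : x ≪ AffineMap.lineMap x y t)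
    (hyz : y ≪ AffineMap.lineMap x y t) (ht : t ≤ 1) :
    t * (klSum y (AffineMap.lineMap x y t) + klSum x r) ≤ t * klSum y r := by
  have hzr := hxr.lineMap hyr hxz.nonneg_right
  have hmin := h.klSum_le hz hzr
  rw [klSum_lineMap hxz hyz hzr] at hmin
  have hpos := mul_nonneg (sub_nonneg.2 ht) (klSum_nonneg hxz.nonneg_left hxz.nonneg_right)
  linarith

theorem IsKLProj.klSum_lineMap_add_le (h : IsKLProj S r x) (hS : Convex ℝ S) (hy : y ∈ S)
    (hyr : y ≪ r) (ht : 0 < t) (ht1 : t < 1) :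
    klSum y (AffineMap.lineMap x y t) + klSum x r ≤ klSum y r := by
  have hxr := h.dominated hy hyr
  exact le_of_mul_le_mul_left
    (h.mul_klSum_add_le hxr hyr (hS.lineMap_mem h.1 hy ⟨ht.le, ht1.le⟩)
      (.lineMap_left hxr.nonneg_left hyr.nonneg_left ht.le ht1)
      (.lineMap_right hxr.nonneg_left hyr.nonneg_left ht ht1.le) ht1.le) ht

/-- Otherwise the slope of the divergence at `x` in the direction of `y` would be `-∞`. -/
theorem IsKLProj.dominates (h : IsKLProj S r x) (hS : Convex ℝ S) (hy : y ∈ S) (hyr : y ≪ r) :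
    y ≪ x := by
  have hxr := h.dominated hy hyr
  refine ⟨hyr.nonneg_left, hxr.nonneg_left, fun j hxj => by_contra fun hyj => ?_⟩
  have hyj : 0 < y j := (hyr.nonneg_left j).lt_of_ne' hyj
  have hslope : ∀ c : ℝ, 0 < c → y j * (c - 1) ≤ klSum y r - klSum x r := fun c hc => by
    have ht : 0 < Real.exp (-c) := Real.exp_pos _
    have ht1 : Real.exp (-c) < 1 := Real.exp_lt_one_iff.2 (neg_neg_of_pos hc)
    have hyz := Dominated.lineMap_right hxr.nonneg_left hyr.nonneg_left ht ht1.le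
    have hzj : AffineMap.lineMap x y (Real.exp (-c)) j = Real.exp (-c) * y j := by
      simp [AffineMap.lineMap_apply_module, hxj]
    have hterm := mul_klFun_div_le_klSum hyz.nonneg_left hyz.nonneg_right j
    rw [mul_klFun_div (hyz.eq_zero j), hzj, div_mul_cancel_right₀ hyj.ne', ← Real.exp_neg,
      Real.log_exp, neg_neg] at hterm
    linarith [h.klSum_lineMap_add_le hS hy hyr ht ht1, mul_pos ht hyj]
  have hK : 0 ≤ klSum y r - klSum x r := sub_nonneg.2 (h.klSum_le hy hyr)
  have hc := hslope ((klSum y r - klSum x r) / y j + 2) (by positivity)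
  rw [add_sub_assoc, mul_add, mul_div_cancel₀ _ hyj.ne'] at hc
  linarith

theorem Dominated.tendsto_klSum_lineMap (h : y ≪ x) (s : Set ℝ) :
    Tendsto (fun t : ℝ => klSum y (AffineMap.lineMap x y t)) (𝓝[s] 0) (𝓝 (klSum y x)) :=
  h.tendsto_klSum <| (AffineMap.lineMap_continuous.tendsto' 0 x
    (AffineMap.lineMap_apply_zero x y)).mono_left nhdsWithin_le_nhds

theorem IsKLProj.klSum_add_le (h : IsKLProj S r x) (hS : Convex ℝ S) (hy : y ∈ S)
    (hyr : y ≪ r) : klSum y x + klSum x r ≤ klSum y r := by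
  refine le_of_tendsto (((h.dominates hS hy hyr).tendsto_klSum_lineMap (Ioi 0)).add_const _) ?_
  filter_upwards [Ioo_mem_nhdsGT one_pos] with t ht
  exact h.klSum_lineMap_add_le hS hy hyr ht.1 ht.2

/-- On an affine subspace equality holds since the line from `y` through `x` can be followed beyond
`x`. -/
theorem IsKLProj.klSum_add_eq {E : AffineSubspace ℝ (Fin M → ℝ)}
    (h : IsKLProj ((E : Set (Fin M → ℝ)) ∩ Ici 0) r x) (hy : y ∈ (E : Set (Fin M → ℝ)) ∩ Ici 0)
    (hyr : y ≪ r) : klSum y x + klSum x r = klSum y r := by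
  have hS : Convex ℝ ((E : Set (Fin M → ℝ)) ∩ Ici 0) := E.convex.inter (convex_Ici 0)
  have hyx := h.dominates hS hy hyr
  refine (h.klSum_add_le hS hy hyr).antisymm
    (ge_of_tendsto ((hyx.tendsto_klSum_lineMap (Iio 0)).add_const _) ?_)
  filter_upwards [nhdsWithin_le_nhds hyx.eventually_lineMap, self_mem_nhdsWithin] with t hxz ht
  exact (mul_le_mul_left_of_neg ht).1 <| h.mul_klSum_add_le (h.dominated hy hyr) hyr
    ⟨AffineMap.lineMap_mem t h.1.1 hy.1, hxz.nonneg_right⟩ hxz (hyx.trans hxz)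
    ((mem_Iio.1 ht).le.trans zero_le_one)

theorem existsUnique_isKLProj (hS : Convex ℝ S) (hc : IsCompact S) (hx : x ∈ S) (hxr : x ≪ r) :
    ∃! z, IsKLProj S r z := by
  obtain ⟨z, ⟨hz, hzr⟩, hmin⟩ :=
    (hc.inter_right (Dominated.isClosed_setOf hxr.nonneg_right)).exists_isMinOn ⟨x, hx, hxr⟩
      (continuous_klSum_left r).continuousOn
  have hproj := isKLProj_of_forall_klSum_le hz hzr fun y hy hyr => hmin ⟨hy, hyr⟩
  refine ⟨z, hproj, fun y hy => (hproj.dominates hS hy.1 ?_).eq_of_klSum_nonpos ?_⟩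
  · exact hy.dominated hx hxr
  · linarith [hproj.klSum_add_le hS hy.1 (hy.dominated hx hxr), hy.klSum_le hz hzr]

variable {m : ℕ}

/-- The affine subspace of `ℝ^M` cut out by `𝟙ᵀ x = 1` and `A x = b`. -/
def constraintSpace (A : Matrix (Fin m) (Fin M) ℝ) (b : Fin m → ℝ) :
    AffineSubspace ℝ (Fin M → ℝ) where
  carrier := {x | ∑ j, x j = 1 ∧ A *ᵥ x = b}
  smul_vsub_vadd_mem' := by
    rintro c x y z ⟨hx, hxA⟩ ⟨hy, hyA⟩ ⟨hz, hzA⟩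
    refine ⟨?_, ?_⟩
    · simp [Finset.sum_add_distrib, ← Finset.mul_sum, hx, hy, hz]
    · simp [Matrix.mulVec_add, Matrix.mulVec_sub, Matrix.mulVec_smul, hxA, hyA, hzA]

variable (A : Matrix (Fin m) (Fin M) ℝ) (b : Fin m → ℝ)

theorem affineSubset_eq :
    affineSubset A b = (constraintSpace A b : Set (Fin M → ℝ)) ∩ Ici 0 := by
  ext x
  exact ⟨fun h => ⟨⟨h.1.2, h.2⟩, h.1.1⟩, fun h => ⟨⟨h.2, h.1.1⟩, h.1.2⟩⟩

theorem convex_affineSubset : Convex ℝ (affineSubset A b) :=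
  affineSubset_eq A b ▸ (constraintSpace A b).convex.inter (convex_Ici 0)

theorem isCompact_affineSubset : IsCompact (affineSubset A b) :=
  (isCompact_stdSimplex ℝ _).inter_right
    (isClosed_eq (continuous_const.matrix_mulVec continuous_id) continuous_const)

end Projection

section EqualGain

variable {ι : Type*} [Fintype ι]

/-- A step from `p` to `p'` which decreases the divergence from all points of `C` by one and the
same amount. Only the points `x ≪ p`, whose divergence from `p` is finite, are considered. -/
structure IsKLStep (C : Set (ι → ℝ)) (p p' : ι → ℝ) : Prop where
  dominated : p' ≪ p
  dominates : ∀ x ∈ C, x ≪ p → x ≪ p'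
  klSum_le : ∀ x ∈ C, x ≪ p → klSum x p' ≤ klSum x p
  gain_eq : ∀ x ∈ C, ∀ y ∈ C, x ≪ p → y ≪ p →
    klSum x p - klSum x p' = klSum y p - klSum y p'

namespace IsKLStep

variable {C D : Set (ι → ℝ)} {p p' p'' : ι → ℝ}

theorem refl (hp : 0 ≤ p) : IsKLStep C p p where
  dominated := .refl hp
  dominates _ _ hxp := hxp
  klSum_le _ _ _ := le_rfl
  gain_eq _ _ _ _ _ _ := by rw [sub_self, sub_self]

theorem trans (h : IsKLStep C p p') (h' : IsKLStep C p' p'') : IsKLStep C p p'' where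
  dominated := h'.dominated.trans h.dominated
  dominates x hx hxp := h'.dominates x hx (h.dominates x hx hxp)
  klSum_le x hx hxp := (h'.klSum_le x hx (h.dominates x hx hxp)).trans (h.klSum_le x hx hxp)
  gain_eq x hx y hy hxp hyp := by
    linarith [h.gain_eq x hx y hy hxp hyp,
      h'.gain_eq x hx y hy (h.dominates x hx hxp) (h.dominates y hy hyp)]

theorem mono (h : IsKLStep D p p') (hCD : C ⊆ D) : IsKLStep C p p' where
  dominated := h.dominated
  dominates x hx := h.dominates x (hCD hx)
  klSum_le x hx := h.klSum_le x (hCD hx)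
  gain_eq x hx y hy := h.gain_eq x (hCD hx) y (hCD hy)

variable {p : ℕ → ι → ℝ} (hp : ∀ k, IsKLStep C (p k) (p (k + 1))) {x y : ι → ℝ}

include hp

theorem of_forall_succ (h0 : 0 ≤ p 0) (k : ℕ) : IsKLStep C (p 0) (p k) := by
  induction k with
  | zero => exact refl h0
  | succ k ih => exact ih.trans (hp k)

theorem dominates_apply (hx : x ∈ C) (hxp : x ≪ p 0) (k : ℕ) : x ≪ p k :=
  (of_forall_succ hp hxp.nonneg_right k).dominates x hx hxp

theorem antitone_klSum (hx : x ∈ C) (hxp : x ≪ p 0) : Antitone fun k => klSum x (p k) :=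
  antitone_nat_of_succ_le fun k => (hp k).klSum_le x hx (dominates_apply hp hx hxp k)

theorem exists_tendsto_klSum (hx : x ∈ C) (hxp : x ≪ p 0) :
    ∃ d, Tendsto (fun k => klSum x (p k)) atTop (𝓝 d) :=
  ⟨_, tendsto_atTop_ciInf (antitone_klSum hp hx hxp) ⟨0, forall_mem_range.2 fun k =>
    klSum_nonneg hxp.nonneg_left (dominates_apply hp hx hxp k).nonneg_right⟩⟩

theorem tendsto_gain (hx : x ∈ C) (hxp : x ≪ p 0) :
    Tendsto (fun k => klSum x (p k) - klSum x (p (k + 1))) atTop (𝓝 0) := by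
  obtain ⟨d, hd⟩ := exists_tendsto_klSum hp hx hxp
  simpa using hd.sub (hd.comp (tendsto_add_atTop_nat 1))

theorem tendsto_of_mapClusterPt (hy : y ∈ C) (hyp : y ≪ p 0) (hcl : MapClusterPt y atTop p) :
    Tendsto p atTop (𝓝 y) := by
  obtain ⟨d, hd⟩ := exists_tendsto_klSum hp hy hyp
  obtain ⟨U, hU, hpU⟩ := mapClusterPt_iff_ultrafilter.1 hcl
  have hd0 : d = 0 := by
    rw [← klSum_self y]
    exact tendsto_nhds_unique (hd.mono_left hU)
      ((Dominated.refl hyp.nonneg_left).tendsto_klSum hpU)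
  exact (tendsto_iff_of_tendsto_klSum (.of_forall (dominates_apply hp hy hyp)) (hd0 ▸ hd)).1
    tendsto_const_nhds

theorem klSum_le_of_tendsto (hy : y ∈ C) (hyp : y ≪ p 0) (hlim : Tendsto p atTop (𝓝 y))
    (hx : x ∈ C) (hxp : x ≪ p 0) : klSum y (p 0) ≤ klSum x (p 0) := by
  have hd := (Dominated.refl hyp.nonneg_left).tendsto_klSum hlim
  rw [klSum_self] at hd
  refine sub_nonpos.1 (ge_of_tendsto' hd fun k => ?_)
  have hk := of_forall_succ hp hxp.nonneg_right k
  linarith [hk.gain_eq x hx y hy hxp hyp,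
    klSum_nonneg hxp.nonneg_left (hk.dominates x hx hxp).nonneg_right]

end IsKLStep

theorem exists_mapClusterPt_mem_iInter {X : Type*} [TopologicalSpace X] {n : ℕ} [NeZero n]
    {K : Set X} {S : Fin n → Set X} {p : ℕ → X} (hK : IsCompact K) (hpK : ∀ᶠ k in atTop, p k ∈ K)
    (hstep : ∀ (i : Fin n) (l : Filter ℕ) [l.NeBot] (y : X), l ≤ atTop →
      (∀ᶠ k in l, Fin.ofNat n k = i) → Tendsto p l (𝓝 y) →
        y ∈ S i ∧ Tendsto (fun k => p (k + 1)) l (𝓝 y)) :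
    ∃ y ∈ ⋂ i, S i, MapClusterPt y atTop p := by
  let U : Ultrafilter ℕ := Ultrafilter.of atTop
  have hblock : ∀ s, Tendsto (fun k => n * k + s) U atTop := fun s =>
    (tendsto_atTop_mono (fun k => (Nat.le_mul_of_pos_left k (NeZero.pos n)).trans
      (Nat.le_add_right _ s)) tendsto_id).mono_left (Ultrafilter.of_le _)
  obtain ⟨y, -, hy⟩ :=
    hK.ultrafilter_le_nhds' (U.map fun k => p (n * k)) ((hblock 0).eventually hpK)
  have hshift : ∀ (i : Fin n) (s : ℕ), s % n = i → Tendsto (fun k => p (n * k + s)) U (𝓝 y) →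
      y ∈ S i ∧ Tendsto (fun k => p (n * k + s + 1)) U (𝓝 y) := fun i s hs hys =>
    hstep i (map (fun k => n * k + s) U) y (hblock s)
      (eventually_map.2 <| .of_forall fun k => Fin.ext <| by simp [Fin.ofNat, hs]) hys
  have hlim : ∀ s, Tendsto (fun k => p (n * k + s)) U (𝓝 y) := fun s => by
    induction s with
    | zero => exact hy
    | succ s ih => exact (hshift (Fin.ofNat n s) s rfl ih).2
  refine ⟨y, mem_iInter.2 fun i => (hshift i i (Nat.mod_eq_of_lt i.2) (hlim i)).1, ?_⟩
  exact mapClusterPt_iff_ultrafilter.2 ⟨U.map fun k => n * k, hblock 0, hy⟩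

end EqualGain

section ProjectionStep

variable {M : ℕ} {S : Set (Fin M → ℝ)} {r x y : Fin M → ℝ}

theorem IsKLProj.isKLStep {E : AffineSubspace ℝ (Fin M → ℝ)}
    (h : IsKLProj ((E : Set (Fin M → ℝ)) ∩ Ici 0) r x) (hy : y ∈ (E : Set (Fin M → ℝ)) ∩ Ici 0)
    (hyr : y ≪ r) : IsKLStep ((E : Set (Fin M → ℝ)) ∩ Ici 0) r x := by
  have hxr := h.dominated hy hyr
  have hnonneg := klSum_nonneg hxr.nonneg_left hxr.nonneg_right
  refine ⟨hxr, fun z => h.dominates (E.convex.inter (convex_Ici 0)), fun z hz hzr => ?_,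
    fun z hz w hw hzr hwr => ?_⟩
  · linarith [h.klSum_add_eq hz hzr]
  · linarith [h.klSum_add_eq hz hzr, h.klSum_add_eq hw hwr]

theorem tendsto_of_isKLProj {α : Type*} {l : Filter α} {f g : α → Fin M → ℝ} (hS : Convex ℝ S)
    (hx : x ∈ S) (hxf : ∀ᶠ k in l, x ≪ f k) (hproj : ∀ᶠ k in l, IsKLProj S (f k) (g k))
    (hgain : Tendsto (fun k => klSum x (f k) - klSum x (g k)) l (𝓝 0))
    (hf : Tendsto f l (𝓝 y)) : Tendsto g l (𝓝 y) := by
  have hdom : ∀ᶠ k in l, g k ≪ f k := by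
    filter_upwards [hxf, hproj] with k hxk hk
    exact hk.dominated hx hxk
  refine (tendsto_iff_of_tendsto_klSum hdom (squeeze_zero' ?_ ?_ hgain)).2 hf
  · filter_upwards [hdom] with k hk
    exact klSum_nonneg hk.nonneg_left hk.nonneg_right
  · filter_upwards [hxf, hproj] with k hxk hk
    linarith [hk.klSum_add_le hS hx hxk]

end ProjectionStep

section NonnegMatrix

variable {ι κ : Type*} [Fintype κ] {A : Matrix ι κ ℝ} {p x : κ → ℝ}

theorem mul_eq_zero_of_mulVec_eq_zero (hA : ∀ i j, 0 ≤ A i j) (hp : 0 ≤ p) {i : ι}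
    (hi : (A *ᵥ p) i = 0) (j : κ) : A i j * p j = 0 :=
  (Finset.sum_eq_zero_iff_of_nonneg fun j _ => mul_nonneg (hA i j) (hp j)).1 hi j
    (Finset.mem_univ j)

theorem Dominated.mulVec (h : x ≪ p) (hA : ∀ i j, 0 ≤ A i j) : A *ᵥ x ≪ A *ᵥ p where
  nonneg_left i := dotProduct_nonneg_of_nonneg (hA i) h.nonneg_left
  nonneg_right i := dotProduct_nonneg_of_nonneg (hA i) h.nonneg_right
  eq_zero i hi := Finset.sum_eq_zero fun j _ => by
    rcases mul_eq_zero.1 (mul_eq_zero_of_mulVec_eq_zero hA h.nonneg_right hi j) with hij | hj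
    · exact mul_eq_zero_of_left hij _
    · exact mul_eq_zero_of_right _ (h.eq_zero j hj)

end NonnegMatrix

/-- A nonnegative system `A x = b` in which all column sums of `A` and the sum of `b` are `1`, as
required by generalized iterative scaling. -/
structure IsNormalized {ι : Type} [Fintype ι] {M : ℕ} (A : Matrix ι (Fin M) ℝ) (b : ι → ℝ) :
    Prop where
  matrix_nonneg : ∀ i j, 0 ≤ A i j
  colSum : ∀ j, ∑ i, A i j = 1
  rhs_nonneg : 0 ≤ b
  rhsSum : ∑ i, b i = 1

namespace IsNormalized

variable {ι : Type} [Fintype ι] {M : ℕ} {A : Matrix ι (Fin M) ℝ} {b : ι → ℝ} {p x y : Fin M → ℝ}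
  (hAb : IsNormalized A b)

include hAb

theorem sum_mulVec (p : Fin M → ℝ) : ∑ i, (A *ᵥ p) i = ∑ j, p j := by
  have hone : (1 : ι → ℝ) ᵥ* A = 1 := funext fun j => by
    simp [Matrix.vecMul, one_dotProduct, hAb.colSum]
  rw [← one_dotProduct, Matrix.dotProduct_mulVec, hone, one_dotProduct]

theorem ratio_nonneg (hp : 0 ≤ p) (i : ι) : 0 ≤ b i / (A *ᵥ p) i :=
  div_nonneg (hAb.rhs_nonneg i) (dotProduct_nonneg_of_nonneg (hAb.matrix_nonneg i) hp)

theorem gisStep_dominated (hp : 0 ≤ p) : gisStep A b p ≪ p where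
  nonneg_left j := mul_nonneg (hp j) (Finset.prod_nonneg fun i _ =>
    Real.rpow_nonneg (hAb.ratio_nonneg hp i) _)
  nonneg_right := hp
  eq_zero _ hj := mul_eq_zero_of_left hj _

theorem gisStep_le (hp : 0 ≤ p) (j : Fin M) :
    gisStep A b p j ≤ ∑ i, A i j * p j * (b i / (A *ᵥ p) i) := by
  have hmean := Real.geom_mean_le_arith_mean_weighted Finset.univ (fun i => A i j)
    (fun i => b i / (A *ᵥ p) i) (fun i _ => hAb.matrix_nonneg i j) (hAb.colSum j)
    (fun i _ => hAb.ratio_nonneg hp i)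
  calc gisStep A b p j ≤ p j * ∑ i, A i j * (b i / (A *ᵥ p) i) :=
        mul_le_mul_of_nonneg_left hmean (hp j)
    _ = ∑ i, A i j * p j * (b i / (A *ᵥ p) i) := by
        rw [Finset.mul_sum]
        exact Finset.sum_congr rfl fun i _ => by ring

theorem sum_gisStep_le (hp : 0 ≤ p) : ∑ j, gisStep A b p j ≤ 1 :=
  calc ∑ j, gisStep A b p j ≤ ∑ j, ∑ i, A i j * p j * (b i / (A *ᵥ p) i) :=
        Finset.sum_le_sum fun j _ => hAb.gisStep_le hp j
    _ = ∑ i, (A *ᵥ p) i * (b i / (A *ᵥ p) i) := by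
        rw [Finset.sum_comm]
        exact Finset.sum_congr rfl fun i _ => (Finset.sum_mul _ _ _).symm
    _ ≤ ∑ i, b i := Finset.sum_le_sum fun i _ => by
        by_cases h : (A *ᵥ p) i = 0
        · simpa [h] using hAb.rhs_nonneg i
        · exact (mul_div_cancel₀ _ h).le
    _ = 1 := hAb.rhsSum

theorem rhs_dominated (hxA : A *ᵥ x = b) (hxp : x ≪ p) : b ≪ A *ᵥ p :=
  hxA ▸ hxp.mulVec hAb.matrix_nonneg

theorem ratio_pos (hxA : A *ᵥ x = b) (hxp : x ≪ p) {i : ι} {j : Fin M} (hj : x j ≠ 0)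
    (hij : A i j ≠ 0) : 0 < b i / (A *ᵥ p) i := by
  have hb : b i ≠ 0 := fun hb => mul_ne_zero hij hj <|
    mul_eq_zero_of_mulVec_eq_zero hAb.matrix_nonneg hxp.nonneg_left (hxA ▸ hb) j
  exact div_pos ((hAb.rhs_nonneg i).lt_of_ne' hb) ((hAb.rhs_dominated hxA hxp).pos_right hb)

theorem factor_pos (hxA : A *ᵥ x = b) (hxp : x ≪ p) {j : Fin M} (hj : x j ≠ 0) (i : ι) :
    0 < (b i / (A *ᵥ p) i) ^ A i j := by
  by_cases hij : A i j = 0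
  · simp [hij]
  · exact Real.rpow_pos_of_pos (hAb.ratio_pos hxA hxp hj hij) _

theorem dominated_gisStep (hxA : A *ᵥ x = b) (hxp : x ≪ p) : x ≪ gisStep A b p where
  nonneg_left := hxp.nonneg_left
  nonneg_right := (hAb.gisStep_dominated hxp.nonneg_right).nonneg_left
  eq_zero _ hj := by_contra fun hxj => mul_ne_zero (hxp.pos_right hxj).ne'
    (Finset.prod_pos fun i _ => hAb.factor_pos hxA hxp hxj i).ne' hj

theorem mul_log_gisStep_div (hxA : A *ᵥ x = b) (hxp : x ≪ p) (j : Fin M) :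
    x j * Real.log (gisStep A b p j / p j) =
      ((fun i => Real.log (b i / (A *ᵥ p) i)) ᵥ* A) j * x j := by
  by_cases hj : x j = 0
  · simp [hj]
  rw [gisStep, mul_div_cancel_left₀ _ (hxp.pos_right hj).ne',
    Real.log_prod fun i _ => (hAb.factor_pos hxA hxp hj i).ne', mul_comm]
  congr 1
  refine Finset.sum_congr rfl fun i _ => ?_
  by_cases hij : A i j = 0
  · simp [hij]
  · rw [Real.log_rpow (hAb.ratio_pos hxA hxp hj hij), mul_comm]

theorem klSum_sub_klSum_gisStep (hxA : A *ᵥ x = b) (hxp : x ≪ p) :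
    klSum x p - klSum x (gisStep A b p) =
      klSum b (A *ᵥ p) + (1 - ∑ j, gisStep A b p j) := by
  set L : ι → ℝ := fun i => Real.log (b i / (A *ᵥ p) i)
  have hlog : ∑ j, x j * Real.log (gisStep A b p j / p j) = ∑ i, b i * L i :=
    calc ∑ j, x j * Real.log (gisStep A b p j / p j) = (L ᵥ* A) ⬝ᵥ x :=
          Finset.sum_congr rfl fun j _ => hAb.mul_log_gisStep_div hxA hxp j
      _ = b ⬝ᵥ L := by rw [← Matrix.dotProduct_mulVec, hxA, dotProduct_comm]
  rw [(hAb.dominated_gisStep hxA hxp).klSum_sub_klSum (hAb.gisStep_dominated hxp.nonneg_right),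
    (hAb.rhs_dominated hxA hxp).klSum_eq, hAb.sum_mulVec, hAb.rhsSum, hlog]
  ring

theorem klSum_rhs_le (hxA : A *ᵥ x = b) (hxp : x ≪ p) :
    klSum b (A *ᵥ p) ≤ klSum x p - klSum x (gisStep A b p) := by
  linarith [hAb.klSum_sub_klSum_gisStep hxA hxp, hAb.sum_gisStep_le hxp.nonneg_right]

theorem klSum_rhs_nonneg (hxA : A *ᵥ x = b) (hxp : x ≪ p) : 0 ≤ klSum b (A *ᵥ p) :=
  klSum_nonneg hAb.rhs_nonneg (hAb.rhs_dominated hxA hxp).nonneg_right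

theorem isKLStep_gisStep (hp : 0 ≤ p) : IsKLStep {x | A *ᵥ x = b} p (gisStep A b p) where
  dominated := hAb.gisStep_dominated hp
  dominates _ := hAb.dominated_gisStep
  klSum_le _ hxA hxp :=
    sub_nonneg.1 ((hAb.klSum_rhs_nonneg hxA hxp).trans (hAb.klSum_rhs_le hxA hxp))
  gain_eq _ hxA _ hyA hxp hyp := by
    rw [hAb.klSum_sub_klSum_gisStep hxA hxp, hAb.klSum_sub_klSum_gisStep hyA hyp]

section Limits

variable {α : Type*} {l : Filter α} {f : α → Fin M → ℝ}

theorem mulVec_eq_of_tendsto_gain [l.NeBot] (hxA : A *ᵥ x = b) (hxf : ∀ᶠ k in l, x ≪ f k)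
    (hgain : Tendsto (fun k => klSum x (f k) - klSum x (gisStep A b (f k))) l (𝓝 0))
    (hf : Tendsto f l (𝓝 y)) : A *ᵥ y = b := by
  have hkl : Tendsto (fun k => klSum b (A *ᵥ f k)) l (𝓝 0) :=
    squeeze_zero' (hxf.mono fun _ => hAb.klSum_rhs_nonneg hxA)
      (hxf.mono fun _ => hAb.klSum_rhs_le hxA) hgain
  have hAf : Tendsto (fun k => A *ᵥ f k) l (𝓝 b) :=
    (tendsto_iff_of_tendsto_klSum (hxf.mono fun _ => hAb.rhs_dominated hxA) hkl).1
      tendsto_const_nhds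
  exact tendsto_nhds_unique
    (((continuous_const.matrix_mulVec continuous_id).tendsto y).comp hf) hAf

theorem tendsto_gisStep (hy : 0 ≤ y) (hyA : A *ᵥ y = b) (hf : Tendsto f l (𝓝 y)) :
    Tendsto (fun k => gisStep A b (f k)) l (𝓝 y) := by
  have hAf : Tendsto (fun k => A *ᵥ f k) l (𝓝 b) := hyA ▸
    ((continuous_const.matrix_mulVec continuous_id).tendsto y).comp hf
  refine tendsto_pi_nhds.2 fun j => ?_
  by_cases hj : ∃ i, b i = 0 ∧ A i j ≠ 0
  · obtain ⟨i, hbi, hij⟩ := hj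
    have hyj : y j = 0 := (mul_eq_zero.1 (mul_eq_zero_of_mulVec_eq_zero hAb.matrix_nonneg hy
      (hyA ▸ hbi) j)).resolve_left hij
    have hzero : ∀ k, gisStep A b (f k) j = 0 := fun k =>
      mul_eq_zero_of_right _ <| Finset.prod_eq_zero (Finset.mem_univ i) <| by
        rw [hbi, zero_div, Real.zero_rpow hij]
    simp only [hzero, hyj, tendsto_const_nhds]
  · push Not at hj
    have hfactor : ∀ i, Tendsto (fun k => (b i / (A *ᵥ f k) i) ^ A i j) l (𝓝 1) := fun i => by
      by_cases hij : A i j = 0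
      · simpa [hij] using tendsto_const_nhds
      have hbi : b i ≠ 0 := mt (hj i) hij
      have hratio := (tendsto_const_nhds (x := b i)).div (tendsto_pi_nhds.1 hAf i) hbi
      rw [div_self hbi] at hratio
      simpa using hratio.rpow_const (p := A i j) (.inl one_ne_zero)
    simpa [gisStep] using
      (tendsto_pi_nhds.1 hf j).mul (tendsto_finsetProd Finset.univ fun i _ => hfactor i)

end Limits

end IsNormalized

section Normalization

variable {m M : ℕ} {A : Matrix (Fin m) (Fin M) ℝ} {b : Fin m → ℝ} {ξ ξ' : ℝ} {x : Fin M → ℝ}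

theorem sum_normRow {f : Fin m → ℝ} {g : NormRow A b ξ ξ' → ℝ} (hg : ∀ i, g (some i) = f i)
    (hf : ∀ i, (∀ j, scaledMatrix A ξ ξ' i j = 0) ∧ scaledRhs b ξ ξ' i = 0 → f i = 0) :
    ∑ r, g r = g none + ∑ i, f i := by
  classical
  have hdeleted : ∑ i : {i // (∀ j, scaledMatrix A ξ ξ' i j = 0) ∧ scaledRhs b ξ ξ' i = 0},
      f i = 0 := Finset.sum_eq_zero fun i _ => hf i i.2
  rw [← Fintype.sum_subtype_add_sum_subtype
    (fun i => (∀ j, scaledMatrix A ξ ξ' i j = 0) ∧ scaledRhs b ξ ξ' i = 0) f, hdeleted, zero_add,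
    ← Finset.sum_congr rfl fun i _ => hg i, ← Fintype.sum_option]
  congr!

theorem normMatrix_mulVec_none (x : Fin M → ℝ) :
    (normMatrix A b ξ ξ' *ᵥ x) none = ∑ j, x j - ∑ i, (scaledMatrix A ξ ξ' *ᵥ x) i := by
  simp only [normMatrix, Matrix.mulVec, dotProduct, Matrix.of_apply]
  rw [Finset.sum_comm, ← Finset.sum_sub_distrib]
  exact Finset.sum_congr rfl fun j _ => by rw [sub_mul, one_mul, Finset.sum_mul]

theorem normMatrix_mulVec_eq_iff (hx : ∑ j, x j = 1) :
    normMatrix A b ξ ξ' *ᵥ x = normRhs A b ξ ξ' ↔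
      scaledMatrix A ξ ξ' *ᵥ x = scaledRhs b ξ ξ' := by
  refine ⟨fun h => funext fun i => ?_, fun h => funext fun r => ?_⟩
  · by_cases hi : (∀ j, scaledMatrix A ξ ξ' i j = 0) ∧ scaledRhs b ξ ξ' i = 0
    · have hrow : ∑ j, scaledMatrix A ξ ξ' i j * x j = 0 :=
        Finset.sum_eq_zero fun j _ => mul_eq_zero_of_left (hi.1 j) _
      exact hrow.trans hi.2.symm
    · exact congrFun h (some ⟨i, hi⟩)
  · rcases r with _ | i
    · rw [normMatrix_mulVec_none, hx, h]
      rfl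
    · exact congrFun h i

theorem scaledMatrix_mulVec (hx : ∑ j, x j = 1) (i : Fin m) :
    (scaledMatrix A ξ ξ' *ᵥ x) i = 1 / ξ' * ((A *ᵥ x) i - ξ) :=
  calc ∑ j, 1 / ξ' * (A i j - ξ) * x j = 1 / ξ' * (∑ j, A i j * x j - ξ * ∑ j, x j) := by
        rw [Finset.mul_sum, ← Finset.sum_sub_distrib, Finset.mul_sum]
        exact Finset.sum_congr rfl fun j _ => by ring
    _ = 1 / ξ' * ((A *ᵥ x) i - ξ) := by rw [hx, mul_one]; rfl

namespace IsAdmissible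

theorem scale_nonneg (h : IsAdmissible A b ξ ξ') : 0 ≤ ξ' :=
  (Finset.sum_nonneg fun i _ => sub_nonneg.2 (h.shift_le_rhs i)).trans h.rhsSum_le_scale

theorem scaledMatrix_nonneg (h : IsAdmissible A b ξ ξ') (i : Fin m) (j : Fin M) :
    0 ≤ scaledMatrix A ξ ξ' i j :=
  mul_nonneg (one_div_nonneg.2 h.scale_nonneg) (sub_nonneg.2 (h.shift_le_matrix i j))

theorem scaledRhs_nonneg (h : IsAdmissible A b ξ ξ') (i : Fin m) : 0 ≤ scaledRhs b ξ ξ' i :=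
  mul_nonneg (one_div_nonneg.2 h.scale_nonneg) (sub_nonneg.2 (h.shift_le_rhs i))

theorem sum_scaledMatrix_le_one (h : IsAdmissible A b ξ ξ') (j : Fin M) :
    ∑ i, scaledMatrix A ξ ξ' i j ≤ 1 := by
  simp only [scaledMatrix, Matrix.of_apply, one_div_mul_eq_div, ← Finset.sum_div]
  exact div_le_one_of_le₀ (h.colSum_le_scale j) h.scale_nonneg

theorem sum_scaledRhs_le_one (h : IsAdmissible A b ξ ξ') : ∑ i, scaledRhs b ξ ξ' i ≤ 1 := by
  simp only [scaledRhs, one_div_mul_eq_div, ← Finset.sum_div]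
  exact div_le_one_of_le₀ h.rhsSum_le_scale h.scale_nonneg

theorem isNormalized (h : IsAdmissible A b ξ ξ') :
    IsNormalized (normMatrix A b ξ ξ') (normRhs A b ξ ξ') where
  matrix_nonneg
    | none, j => sub_nonneg.2 (h.sum_scaledMatrix_le_one j)
    | some i, j => h.scaledMatrix_nonneg i j
  colSum j := by
    rw [sum_normRow (f := fun i => scaledMatrix A ξ ξ' i j) (fun _ => rfl) fun i hi => hi.1 j]
    exact sub_add_cancel _ _
  rhs_nonneg
    | none => sub_nonneg.2 h.sum_scaledRhs_le_one
    | some i => h.scaledRhs_nonneg i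
  rhsSum := by
    rw [sum_normRow (f := scaledRhs b ξ ξ') (fun _ => rfl) fun i hi => hi.2]
    exact sub_add_cancel _ _

theorem mulVec_eq_of_scale_eq_zero (h : IsAdmissible A b ξ 0) (hx : ∑ j, x j = 1) :
    A *ᵥ x = b := by
  have hzero : ∀ {f : Fin m → ℝ}, (∀ i, ξ ≤ f i) → ∑ i, (f i - ξ) ≤ 0 → ∀ i, f i = ξ :=
    fun hf hsum i => sub_eq_zero.1 <| (Finset.sum_eq_zero_iff_of_nonneg fun i _ =>
      sub_nonneg.2 (hf i)).1 (hsum.antisymm (Finset.sum_nonneg fun i _ => sub_nonneg.2 (hf i))) i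
        (Finset.mem_univ i)
  funext i
  rw [hzero h.shift_le_rhs h.rhsSum_le_scale i]
  calc ∑ j, A i j * x j = ∑ j, ξ * x j := Finset.sum_congr rfl fun j _ => by
        rw [hzero (fun i => h.shift_le_matrix i j) (h.colSum_le_scale j) i]
    _ = ξ := by rw [← Finset.mul_sum, hx, mul_one]

theorem scaledMatrix_mulVec_eq_iff (h : IsAdmissible A b ξ ξ') (hx : ∑ j, x j = 1) :
    scaledMatrix A ξ ξ' *ᵥ x = scaledRhs b ξ ξ' ↔ A *ᵥ x = b := by
  by_cases h0 : ξ' = 0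
  · subst h0
    have hAx := h.mulVec_eq_of_scale_eq_zero hx
    refine iff_of_true (funext fun i => ?_) hAx
    rw [scaledMatrix_mulVec hx, hAx, scaledRhs]
  · simp only [funext_iff, scaledMatrix_mulVec hx, scaledRhs, mul_right_inj' (one_div_ne_zero h0),
      sub_left_inj]

theorem mem_affineSubset_iff (h : IsAdmissible A b ξ ξ') :
    x ∈ affineSubset A b ↔ 0 ≤ x ∧ normMatrix A b ξ ξ' *ᵥ x = normRhs A b ξ ξ' := by
  have hiff : ∑ j, x j = 1 →
      (normMatrix A b ξ ξ' *ᵥ x = normRhs A b ξ ξ' ↔ A *ᵥ x = b) := fun hx =>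
    (normMatrix_mulVec_eq_iff hx).trans (h.scaledMatrix_mulVec_eq_iff hx)
  refine ⟨fun hx => ⟨hx.1.1, (hiff hx.1.2).2 hx.2⟩, fun ⟨hx, hxA⟩ => ?_⟩
  have hsum : ∑ j, x j = 1 := by
    rw [← h.isNormalized.sum_mulVec, hxA, h.isNormalized.rhsSum]
  exact ⟨⟨hx, hsum⟩, (hiff hsum).1 hxA⟩

end IsAdmissible

end Normalization

theorem existsUnique_seq {X : Type*} {R : ℕ → X → X → Prop} {P : X → Prop} {a : X} (ha : P a)
    (hR : ∀ k x, P x → ∃! y, R k x y) (hP : ∀ k x y, P x → R k x y → P y) :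
    ∃! p : ℕ → X, p 0 = a ∧ ∀ k, R k (p k) (p (k + 1)) := by
  have hnext : ∀ k (x : {x // P x}), ∃ y : {y // P y}, R k x y := fun k x => by
    obtain ⟨y, hy⟩ := (hR k x x.2).exists
    exact ⟨⟨y, hP k x y x.2 hy⟩, hy⟩
  choose next hnext using hnext
  let s (k : ℕ) : {x // P x} := Nat.rec ⟨a, ha⟩ next k
  have hs : ∀ k, R k (s k).1 (s (k + 1)).1 := fun k => hnext k (s k)
  refine ⟨fun k => (s k).1, ⟨rfl, hs⟩, fun p ⟨hp0, hp⟩ => funext fun k => ?_⟩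
  induction k with
  | zero => exact hp0
  | succ k ih =>
    have hk : R k (s k).1 (p (k + 1)) := ih ▸ hp k
    exact (hR k (s k).1 (s k).2).unique hk (hs k)

section Run

variable {n M : ℕ} {m : Fin n → ℕ}

/-- One step from `p` to `p'` of the cyclic scheme, using block `i`; see `isRun_iff`. -/
def IsBlockStep (I : Set (Fin n)) (A : (k : Fin n) → Matrix (Fin (m k)) (Fin M) ℝ)
    (b : (k : Fin n) → Fin (m k) → ℝ) (ξ ξ' : Fin n → ℝ) (i : Fin n) (p p' : Fin M → ℝ) : Prop :=
  (i ∈ I →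
      p' = gisStep (normMatrix (A i) (b i) (ξ i) (ξ' i)) (normRhs (A i) (b i) (ξ i) (ξ' i)) p) ∧
    (i ∉ I → IsKLProj (affineSubset (A i) (b i)) p p')

variable {I : Set (Fin n)} {A : (k : Fin n) → Matrix (Fin (m k)) (Fin M) ℝ}
  {b : (k : Fin n) → Fin (m k) → ℝ} {ξ ξ' : Fin n → ℝ} {i : Fin n} {p p' q x y : Fin M → ℝ}

theorem isBlockStep_iff_of_mem (hi : i ∈ I) : IsBlockStep I A b ξ ξ' i p p' ↔
    p' = gisStep (normMatrix (A i) (b i) (ξ i) (ξ' i)) (normRhs (A i) (b i) (ξ i) (ξ' i)) p := by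
  simp [IsBlockStep, hi]

theorem isBlockStep_iff_of_notMem (hi : i ∉ I) :
    IsBlockStep I A b ξ ξ' i p p' ↔ IsKLProj (affineSubset (A i) (b i)) p p' := by
  simp [IsBlockStep, hi]

theorem existsUnique_isBlockStep (hx : x ∈ affineSubset (A i) (b i)) (hxp : x ≪ p) :
    ∃! p', IsBlockStep I A b ξ ξ' i p p' := by
  by_cases hi : i ∈ I
  · simp only [isBlockStep_iff_of_mem hi, existsUnique_eq]
  · simp only [isBlockStep_iff_of_notMem hi]
    exact existsUnique_isKLProj (convex_affineSubset _ _) (isCompact_affineSubset _ _) hx hxp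

theorem IsBlockStep.sum_le_one (h : IsBlockStep I A b ξ ξ' i p p')
    (hξ : i ∈ I → IsAdmissible (A i) (b i) (ξ i) (ξ' i)) (hp : 0 ≤ p) : ∑ j, p' j ≤ 1 := by
  by_cases hi : i ∈ I
  · rw [(isBlockStep_iff_of_mem hi).1 h]
    exact (hξ hi).isNormalized.sum_gisStep_le hp
  · exact ((isBlockStep_iff_of_notMem hi).1 h).1.1.2.le

theorem IsBlockStep.isKLStep (h : IsBlockStep I A b ξ ξ' i p p')
    (hξ : i ∈ I → IsAdmissible (A i) (b i) (ξ i) (ξ' i)) (hx : x ∈ affineSubset (A i) (b i))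
    (hxp : x ≪ p) : IsKLStep (affineSubset (A i) (b i)) p p' := by
  by_cases hi : i ∈ I
  · rw [(isBlockStep_iff_of_mem hi).1 h]
    exact ((hξ hi).isNormalized.isKLStep_gisStep hxp.nonneg_right).mono fun z hz =>
      ((hξ hi).mem_affineSubset_iff.1 hz).2
  · rw [isBlockStep_iff_of_notMem hi] at h
    rw [affineSubset_eq] at h hx ⊢
    exact h.isKLStep hx hxp

theorem tendsto_of_isBlockStep {α : Type*} {l : Filter α} [l.NeBot] {f g : α → Fin M → ℝ}
    (hξ : i ∈ I → IsAdmissible (A i) (b i) (ξ i) (ξ' i)) (hx : x ∈ affineSubset (A i) (b i))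
    (hxf : ∀ᶠ k in l, x ≪ f k) (hstep : ∀ᶠ k in l, IsBlockStep I A b ξ ξ' i (f k) (g k))
    (hgain : Tendsto (fun k => klSum x (f k) - klSum x (g k)) l (𝓝 0))
    (hf : Tendsto f l (𝓝 y)) : y ∈ affineSubset (A i) (b i) ∧ Tendsto g l (𝓝 y) := by
  by_cases hi : i ∈ I
  · simp only [isBlockStep_iff_of_mem hi] at hstep
    have hN := (hξ hi).isNormalized
    have hy : 0 ≤ y := isClosed_Ici.mem_of_tendsto hf (hxf.mono fun k hk => hk.nonneg_right)
    have hyA := hN.mulVec_eq_of_tendsto_gain ((hξ hi).mem_affineSubset_iff.1 hx).2 hxf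
      (hgain.congr' (hstep.mono fun k hk => by rw [hk])) hf
    exact ⟨(hξ hi).mem_affineSubset_iff.2 ⟨hy, hyA⟩,
      (hN.tendsto_gisStep hy hyA hf).congr' (hstep.mono fun k hk => hk.symm)⟩
  · simp only [isBlockStep_iff_of_notMem hi] at hstep
    have hg := tendsto_of_isKLProj (convex_affineSubset _ _) hx hxf hstep hgain hf
    exact ⟨(isCompact_affineSubset _ _).isClosed.mem_of_tendsto hg
      (hstep.mono fun k hk => hk.1), hg⟩

theorem existsUnique_isKLProj_iInter [NeZero n] (hx : x ∈ ⋂ k, affineSubset (A k) (b k))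
    (hxq : x ≪ q) : ∃! y, IsKLProj (⋂ k, affineSubset (A k) (b k)) q y :=
  existsUnique_isKLProj (convex_iInter fun k => convex_affineSubset (A k) (b k))
    ((isCompact_affineSubset (A 0) (b 0)).of_isClosed_subset
      (isClosed_iInter fun k => (isCompact_affineSubset (A k) (b k)).isClosed)
      (iInter_subset _ 0)) hx hxq

variable [NeZero n] {p : ℕ → Fin M → ℝ}

theorem isRun_iff : IsRun q I A b ξ ξ' p ↔
    p 0 = q ∧ ∀ k, IsBlockStep I A b ξ ξ' (Fin.ofNat n k) (p k) (p (k + 1)) := by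
  refine ⟨fun h => ⟨h.init, fun k => ⟨h.gis k _ rfl, h.proj k _ rfl⟩⟩,
    fun ⟨h0, h⟩ => ⟨h0, ?_, ?_⟩⟩
  · rintro k i rfl
    exact (h k).1
  · rintro k i rfl
    exact (h k).2

variable (hξ : ∀ k ∈ I, IsAdmissible (A k) (b k) (ξ k) (ξ' k))
  (hx : x ∈ ⋂ k, affineSubset (A k) (b k)) (hxq : x ≪ q)

include hξ hx hxq

theorem existsUnique_isRun : ∃! p : ℕ → Fin M → ℝ, IsRun q I A b ξ ξ' p := by
  simp only [isRun_iff]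
  rw [mem_iInter] at hx
  exact existsUnique_seq (P := (x ≪ ·)) hxq (fun k p hxp => existsUnique_isBlockStep (hx _) hxp)
    fun k p p' hxp h => (h.isKLStep (hξ _) (hx _) hxp).dominates x (hx _) hxp

namespace IsRun

variable (hp : IsRun q I A b ξ ξ' p)

include hp

theorem dominates (k : ℕ) : x ≪ p k := by
  obtain ⟨h0, h⟩ := isRun_iff.1 hp
  rw [mem_iInter] at hx
  induction k with
  | zero => exact h0 ▸ hxq
  | succ k ih => exact ((h k).isKLStep (hξ _) (hx _) ih).dominates x (hx _) ih

theorem isKLStep (k : ℕ) : IsKLStep (⋂ i, affineSubset (A i) (b i)) (p k) (p (k + 1)) :=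
  (((isRun_iff.1 hp).2 k).isKLStep (hξ _) (mem_iInter.1 hx _)
    (hp.dominates hξ hx hxq k)).mono (iInter_subset _ _)

theorem mem_Icc (k : ℕ) : p (k + 1) ∈ Icc 0 1 := by
  have hnonneg : ∀ k, 0 ≤ p k := fun k => (hp.dominates hξ hx hxq k).nonneg_right
  exact ⟨hnonneg _, fun j => (Finset.single_le_sum (fun j _ => hnonneg _ j)
    (Finset.mem_univ j)).trans (((isRun_iff.1 hp).2 k).sum_le_one (hξ _) (hnonneg k))⟩

theorem exists_mapClusterPt : ∃ y ∈ ⋂ i, affineSubset (A i) (b i), MapClusterPt y atTop p := by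
  have hgain := IsKLStep.tendsto_gain (hp.isKLStep hξ hx hxq) hx (hp.init.symm ▸ hxq)
  refine exists_mapClusterPt_mem_iInter (isCompact_Icc (a := 0) (b := 1)) ?_
    fun i l _ y hl hi hy => tendsto_of_isBlockStep (hξ i) (mem_iInter.1 hx i)
      (.of_forall (hp.dominates hξ hx hxq)) ?_ (hgain.mono_left hl) hy
  · filter_upwards [eventually_ge_atTop 1] with k hk
    obtain ⟨k, rfl⟩ := Nat.exists_eq_add_of_le' hk
    exact hp.mem_Icc hξ hx hxq k
  · filter_upwards [hi] with k hk
    exact hk ▸ (isRun_iff.1 hp).2 k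

theorem exists_isKLProj_tendsto :
    ∃ y, IsKLProj (⋂ k, affineSubset (A k) (b k)) q y ∧ Tendsto p atTop (𝓝 y) := by
  have hstep := hp.isKLStep hξ hx hxq
  obtain ⟨y, hy, hcl⟩ := hp.exists_mapClusterPt hξ hx hxq
  obtain rfl := hp.init
  have hyp : y ≪ p 0 := (Dominated.isClosed_setOf hxq.nonneg_right).mem_of_mapClusterPt hcl
    (.of_forall fun k => (IsKLStep.of_forall_succ hstep hxq.nonneg_right k).dominated)
  have hlim := IsKLStep.tendsto_of_mapClusterPt hstep hy hyp hcl
  exact ⟨y, isKLProj_of_forall_klSum_le hy hyp fun z hz hzp =>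
    IsKLStep.klSum_le_of_tendsto hstep hy hyp hlim hz hzp, hlim⟩

end IsRun

end Run

end KLMix

theorem theorem1_general {n M : ℕ} [NeZero n] (m : Fin n → ℕ)
    (A : (k : Fin n) → Matrix (Fin (m k)) (Fin M) ℝ) (b : (k : Fin n) → Fin (m k) → ℝ)
    (q : Fin M → ℝ) (hC : ∃ x ∈ ⋂ k, KLMix.affineSubset (A k) (b k), KLMix.KL x q ≠ ⊤)
    (I : Set (Fin n)) (ξ ξ' : Fin n → ℝ)
    (hξ : ∀ k ∈ I, KLMix.IsAdmissible (A k) (b k) (ξ k) (ξ' k)) :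
    (∃! p : ℕ → Fin M → ℝ, KLMix.IsRun q I A b ξ ξ' p) ∧
    (∃! x : Fin M → ℝ, KLMix.IsKLProj (⋂ k, KLMix.affineSubset (A k) (b k)) q x) ∧
    ∀ (p : ℕ → Fin M → ℝ) (x : Fin M → ℝ), KLMix.IsRun q I A b ξ ξ' p →
      KLMix.IsKLProj (⋂ k, KLMix.affineSubset (A k) (b k)) q x →
      Tendsto p atTop (𝓝 x) := by
  obtain ⟨z, hz, hzq⟩ := hC
  rw [KLMix.KL_ne_top_iff] at hzq
  have hproj := KLMix.existsUnique_isKLProj_iInter hz hzq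
  refine ⟨KLMix.existsUnique_isRun hξ hz hzq, hproj, fun p x hp hx => ?_⟩
  obtain ⟨y, hy, hlim⟩ := hp.exists_isKLProj_tendsto hξ hz hzq
  rwa [hproj.unique hx hy]

theorem theorem1 {n M : ℕ} [NeZero n] (m : Fin n → ℕ)
    (A : (k : Fin n) → Matrix (Fin (m k)) (Fin M) ℝ) (b : (k : Fin n) → Fin (m k) → ℝ)
    (q : Fin M → ℝ) (hq : ∀ j, 0 < q j)
    (hC : (⋂ k, KLMix.affineSubset (A k) (b k)).Nonempty)
    (I : Set (Fin n)) (ξ ξ' : Fin n → ℝ)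
    (hξ : ∀ k ∈ I, KLMix.IsAdmissible (A k) (b k) (ξ k) (ξ' k)) :
    (∃! p : ℕ → Fin M → ℝ, KLMix.IsRun q I A b ξ ξ' p) ∧
    (∃! x : Fin M → ℝ, KLMix.IsKLProj (⋂ k, KLMix.affineSubset (A k) (b k)) q x) ∧
    ∀ (p : ℕ → Fin M → ℝ) (x : Fin M → ℝ), KLMix.IsRun q I A b ξ ξ' p →
      KLMix.IsKLProj (⋂ k, KLMix.affineSubset (A k) (b k)) q x →
      Tendsto p atTop (𝓝 x) :=
  theorem1_general m A b q (hC.imp fun _ hx => ⟨hx, KLMix.KL_ne_top_iff.2 <|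
    .of_pos (Set.mem_iInter.1 hx 0).1.1 hq⟩) I ξ ξ' hξ
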